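/- **Circuit model (Thompson).** The plane is divided into unit squares, two squares being adjacent when they share a side. A circuit has finitely many nodes, placed in distinct squares, and finitely many wires; a wire joins two nodes by a walk of positive length through adjacent squares and does not run through the square of a node in its interior. Each side of a square is passed at most once by at most one wire, and if a square that holds no node is passed twice, then both passes go straight on (a crossing). The area $A$ is the number of squares that are occupied by nodes or wires. The computation takes $T\ge 1$ clock cycles; in each cycle every wire carries one bit in each direction, the bits sent by a node are a function of its state, and its next state is a function of its state and of the bits it receives (no restriction is put on the state sets and on these functions). The circuit is fully parallel: each of the $n$ input symbols is injected before the first cycle into an input node of its own and determines, together with nothing else, the initial state of that node (the initial states of the other nodes are fixed), and each of the $k$ output bits is read after the last cycle from the state of an output node of its own. The energy is $E=AT$. **Decoding schemes.** Fix $0<\varepsilon<1$. An $(n,k)$-decoder is such a circuit, computing a function $\{0,1,?\}^n\to\{0,1\}^k$, together with an encoding function $\{0,1\}^k\to\{0,1\}^n$. Its block error probability $P_{\mathrm e}$ is the probability that its output differs from the message, when the message consists of $k$ independent fair bits and its encoding is sent through $n$ independent uses of the binary erasure channel with erasure probability $\varepsilon$ (erasure symbol $?$). A decoding scheme is a sequence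 of $(n,k(n))$-decoders whose block lengths $n$ are strictly increasing; $A(n)$, $T(n)$, $E(n)=A(n)T(n)$ and $P_{\mathrm e}(n)$ refer to its decoder of block length $n$. It has asymptotic rate $R$ if $k(n)/n\to R$. For $f:\mathbb N\to\mathbb R$ it is an $f(n)$-decoding scheme if $P_{\mathrm e}(n)<f(n)$ for all sufficiently large $n$. The function $f$ is sub-exponential if $f(n)>0$ for all sufficiently large $n$ and $-\ln f(n)/n\to 0$. Write $\ell(n)=-\ln f(n)$, with the convention $\sqrt{\ell(n)}=0$ where $\ell(n)<0$. For sequences $u,v$ indexed by the block lengths of the scheme, $u=\Omega(v)$ means that there is a constant $c>0$ with $u(n)\ge c\,v(n)$ for all sufficiently large $n$, and $u=\Theta(v)$ means that there are constants $b,c>0$ with $b\,v(n)\le u(n)\le c\,v(n)$ for all sufficiently large $n$. **Theorem.** Let $f$ be sub-exponential, and consider any $f(n)$-decoding scheme (with fully parallel circuits, for the binary erasure channel with erasure probability $\varepsilon$) that has an asymptotic rate $R>0$. 1. If $E(n)=\Theta\bigl(\sqrt{\ell(n)}\;n\bigr)$, then $T(n)=\Omega\bigl(\sqrt{\ell(n)}\bigr)$.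 2. Whatever its energy and its number of clock cycles, in particular if $T(n)$ grows more slowly than $\sqrt{\ell(n)}$, $$E(n)=\Omega\left(\frac{n\,\ell(n)}{T(n)}\right).$$ -/

import Mathlib

open Filter Topology

noncomputable section

namespace VLSI

/-! ## Bachmann–Landau notation for sequences of reals -/

/-- `u = Ω(v)`. -/
def IsOmega (u v : ℕ → ℝ) : Prop :=
  ∃ c : ℝ, 0 < c ∧ ∀ᶠ i in atTop, c * v i ≤ u i

/-- `u = Θ(v)`. -/
def IsTheta (u v : ℕ → ℝ) : Prop :=
  ∃ b c : ℝ, 0 < b ∧ 0 < c ∧ ∀ᶠ i in atTop, b * v i ≤ u i ∧ u i ≤ c * v i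

/-- `g` is sublinear: `g(n) / n → 0`. -/
def IsSublinear (g : ℕ → ℝ) : Prop :=
  Tendsto (fun n : ℕ => g n / (n : ℝ)) atTop (𝓝 0)

/-- `f` is sub-exponential: it is positive and `-ln f(n)` is sublinear, i.e. `f(n) = exp(-o(n))`. -/
def IsSubexponential (f : ℕ → ℝ) : Prop :=
  (∀ᶠ n in atTop, 0 < f n) ∧ IsSublinear (fun n => -Real.log (f n))

/-! ## Layouts on the planar grid of unit squares -/

/-- The unit squares of the plane, two of them being adjacent when they share a side. -/
def gridGraph : SimpleGraph (ℤ × ℤ) where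
  Adj p q := |p.1 - q.1| + |p.2 - q.2| = 1
  symm := ⟨fun p q h => by rwa [abs_sub_comm q.1, abs_sub_comm q.2]⟩
  loopless := ⟨fun p h => by simp at h⟩

/-- A Thompson-model layout: computational nodes and wires placed on the grid. Every square is
empty, or holds one node, or one wire, or the crossing of two wires; wires run from square to
square through the common side. -/
structure Layout where
  Node : Type
  Wire : Type
  [nodeFintype : Fintype Node]
  [wireFintype : Fintype Wire]
  /-- The two ends of a wire. -/
  src : Wire → Node
  tgt : Wire → Node
  /-- The square of a node. -/
  pos : Node → ℤ × ℤ
  pos_injective : Function.Injective pos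
  /-- The squares through which a wire runs, from the square of one end to that of the other. -/
  route : ∀ w, gridGraph.Walk (pos (src w)) (pos (tgt w))
  route_length_pos : ∀ w, 0 < (route w).length
  /-- No wire runs through the square of a node. -/
  route_avoids_nodes : ∀ w i, 0 < i → i < (route w).length → ∀ v, (route w).getVert i ≠ pos v
  /-- At most one wire passes through a side of a square, and at most once. -/
  route_isTrail : ∀ w, (route w).IsTrail
  route_disjoint : ∀ w w', w ≠ w' → List.Disjoint (route w).edges (route w').edges
  /-- Where a square is used twice, the wires go straight on (a crossing). -/
  route_crossing : ∀ w w' i j, i + 1 < (route w).length → j + 1 < (route w').length →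
    (route w).getVert (i + 1) = (route w').getVert (j + 1) → ¬ (w = w' ∧ i = j) →
    (route w).getVert i + (route w).getVert (i + 2) =
      (route w).getVert (i + 1) + (route w).getVert (i + 1)

attribute [instance] Layout.nodeFintype Layout.wireFintype

namespace Layout

variable (L : Layout)

/-- The occupied squares. -/
def occupied : Finset (ℤ × ℤ) :=
  Finset.univ.image L.pos ∪ Finset.univ.biUnion (fun w => (L.route w).support.toFinset)

/-- The area: the number of occupied squares (of side one). -/
def area : ℕ := L.occupied.card

/-- The node at the given end of a wire. -/
def endNode (p : L.Wire × Bool) : L.Node := if p.2 then L.tgt p.1 else L.src p.1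

/-- The wire ends attached to a node. -/
def Port (v : L.Node) : Type := {p : L.Wire × Bool // L.endNode p = v}

/-- The other end of a wire. -/
def opposite (p : L.Wire × Bool) : L.Wire × Bool := (p.1, !p.2)

end Layout

/-! ## Fully parallel circuits -/

/-- A fully parallel clocked circuit with `n` inputs from the alphabet `α` and `k` output bits.
Each input has a node of its own, into which it is injected before the first clock cycle; each
output bit has a node of its own, from which it is read after the last clock cycle. The nodes are
arbitrary synchronous machines: no bound is put on their memory or on the functions that they
compute. In every clock cycle every wire carries one bit in each direction. -/
structure Circuit (α : Type) (n k : ℕ) extends Layout where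
  input : Fin n → Node
  input_injective : Function.Injective input
  output : Fin k → Node
  output_injective : Function.Injective output
  State : Node → Type
  /-- The initial state of a node depends only on the input injected into it, if any. -/
  init : ∀ v, ({j : Fin n // input j = v} → α) → State v
  /-- The bits that a node sends, by its state, on the wires attached to it. -/
  send : ∀ v, State v → toLayout.Port v → Bool
  /-- The next state, from the current one and the bits received in the clock cycle. -/
  step : ∀ v, State v → (toLayout.Port v → Bool) → State v
  /-- The output bit, as a function of the final state of its node. -/
  read : ∀ j, State (output j) → Bool
  /-- The number `T` of clock cycles. -/
  cycles : ℕ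
  cycles_pos : 0 < cycles

namespace Circuit

variable {α : Type} {n k : ℕ} (C : Circuit α n k)

/-- The state of every node after `t` clock cycles, on the input word `x`. -/
def stateAt (x : Fin n → α) : ℕ → ∀ v, C.State v
  | 0 => fun v => C.init v (fun j => x j.1)
  | t + 1 => fun v => C.step v (stateAt x t v) (fun p =>
      C.send (C.endNode (C.opposite p.1)) (stateAt x t _) ⟨C.opposite p.1, rfl⟩)

/-- The function computed by the circuit. -/
def compute (x : Fin n → α) : Fin k → Bool :=
  fun j => C.read j (C.stateAt x C.cycles (C.output j))

/-- The energy `E = A T`. -/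
def energy : ℝ := (C.area : ℝ) * (C.cycles : ℝ)

end Circuit

/-! ## Decoders for the binary erasure channel -/

/-- Transition probabilities of the binary erasure channel with erasure probability `ε`;
`none` is the erasure symbol. -/
def becProb (ε : ℝ) (a : Bool) : Option Bool → ℝ
  | none => ε
  | some b => if b = a then 1 - ε else 0

/-- An `(n,k)`-decoder, together with the code (the encoding function) that it is meant for. -/
structure Decoder (n k : ℕ) where
  circuit : Circuit (Option Bool) n k
  encode : (Fin k → Bool) → (Fin n → Bool)

open scoped Classical in
/-- The block error probability: `k` independent fair bits are encoded and sent through `n`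
independent uses of the erasure channel, and the circuit's estimate is wrong. -/
def Decoder.blockErrorProb {n k : ℕ} (D : Decoder n k) (ε : ℝ) : ℝ :=
  ∑ u : Fin k → Bool, ∑ y : Fin n → Option Bool,
    (1 / 2 : ℝ) ^ k * (∏ i, becProb ε (D.encode u i) (y i)) *
      (if D.circuit.compute y = u then 0 else 1)

/-- A decoding scheme: a sequence of decoders with increasing block lengths. -/
structure DecodingScheme where
  blockLength : ℕ → ℕ
  blockLength_strictMono : StrictMono blockLength
  bits : ℕ → ℕ
  decoder : ∀ i, Decoder (blockLength i) (bits i)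

namespace DecodingScheme

variable (D : DecodingScheme)

/-- For all sufficiently large block lengths `n`, the block error probability is less than
`f n`. -/
def IsFDecoding (ε : ℝ) (f : ℕ → ℝ) : Prop :=
  ∀ᶠ i in atTop, (D.decoder i).blockErrorProb ε < f (D.blockLength i)

/-- The asymptotic rate of the scheme exists and equals `R`. -/
def HasRate (R : ℝ) : Prop :=
  Tendsto (fun i => (D.bits i : ℝ) / (D.blockLength i : ℝ)) atTop (𝓝 R)

/-- The energy of the `i`-th decoder. -/
def energy (i : ℕ) : ℝ := (D.decoder i).circuit.energy

/-- The number of clock cycles of the `i`-th decoder. -/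
def cycles (i : ℕ) : ℝ := ((D.decoder i).circuit.cycles : ℝ)

end DecodingScheme

end VLSI

end

/-! ### Information flow into a part of a circuit, and the error probability -/

namespace VLSI

/-! The core is the bound `A T² ≥ c n l` for a decoder with error probability below `exp (-l)`;
dividing by `T` gives the energy bound. Split the nodes into parts with at most `a` inputs each.
With probability at least `ε ^ a` all inputs of a given part are erased, and its outputs then depend
only on the bits that cross into it. If these bits are fewer than its outputs, at least half of the
messages cannot be produced, so the error probability is at least `ε ^ a / 2`. If the error
probability is smaller, every part must receive as many bits as it has outputs, and summing over the
parts gives `k ≤ 2 T · cut` (`Decoder.bits_le_two_mul_cycles_mul_cut`). Planarity provides a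
partition with a small cut (`Layout.exists_partition`): slice the plane into vertical strips of
width `s`, list the squares strip by strip and row by row, and start a new part after every `a`
inputs. Strip walls cost at most `A / s` wires and each of the at most `n / a` breaks costs `s + 1`.
Taking `s` near `√(A a / n)` gives `k² a ≤ 64 T² A n`; then take `a` proportional to `l` and use `k
≥ ρ n`. -/

open scoped Classical in
/-- If, with the inputs in `J` erased, the outputs in `O` take at most half of the
`2 ^ #O` possible values, then the decoder errs with probability at least `ε ^ #J / 2`. -/
theorem Decoder.half_mul_pow_le_blockErrorProb {n k : ℕ} (D : Decoder n k) {ε : ℝ}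
    (hε0 : 0 ≤ ε) (hε1 : ε ≤ 1) (J : Finset (Fin n)) (O : Finset (Fin k))
    (V : Finset (O → Bool)) (hV : 2 * V.card ≤ 2 ^ O.card)
    (hJ : ∀ y : Fin n → Option Bool, (∀ j ∈ J, y j = none) →
      (fun o : O => D.circuit.compute y o) ∈ V) :
    1 / 2 * ε ^ J.card ≤ D.blockErrorProb ε := by
  have hbec : ∀ a b, 0 ≤ becProb ε a b := by
    rintro a (_ | b)
    · exact hε0
    · simp only [becProb]; split_ifs <;> linarith
  let t : Fin n → Finset (Option Bool) := fun i => if i ∈ J then {none} else Finset.univ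
  -- The probability that all of `J` is erased does not depend on the codeword.
  have herased : ∀ c : Fin n → Bool,
      ∑ y ∈ Fintype.piFinset t, ∏ i, becProb ε (c i) (y i) = ε ^ J.card := by
    intro c
    rw [← Finset.prod_univ_sum t (fun i b => becProb ε (c i) b)]
    have : ∀ i, ∑ b ∈ t i, becProb ε (c i) b = if i ∈ J then ε else 1 := by
      intro i
      by_cases hi : i ∈ J
      · simp [t, hi, becProb]
      · cases c i <;> simp [t, hi, becProb, Fintype.sum_option]
    simp [this]
  let bad : Finset (Fin k → Bool) := Finset.univ.filter fun u => (fun o : O => u o) ∉ V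
  -- A message is determined by its restrictions to `O` and to the complement of `O`.
  have hgood : (Finset.univ.filter fun u : Fin k → Bool => (fun o : O => u o) ∈ V).card
      ≤ V.card * 2 ^ (k - O.card) := by
    have h := Finset.card_le_card_of_injOn
      (s := Finset.univ.filter fun u : Fin k → Bool => (fun o : O => u o) ∈ V)
      (t := V ×ˢ (Finset.univ : Finset ((Oᶜ : Finset (Fin k)) → Bool)))
      (fun u => (fun o => u o, fun o => u o))
      (fun u hu => by simpa using hu)
      (fun u _ v _ huv => by
        simp only [Prod.mk.injEq] at huv
        funext j
        by_cases hj : j ∈ O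
        · exact congrFun huv.1 ⟨j, hj⟩
        · exact congrFun huv.2 ⟨j, Finset.mem_compl.2 hj⟩)
    simpa [Finset.card_product, Finset.card_compl] using h
  have hbad : 2 ^ k ≤ 2 * bad.card := by
    have h1 : (Finset.univ.filter fun u : Fin k → Bool => (fun o : O => u o) ∈ V).card
        + bad.card = 2 ^ k := by
      rw [Finset.card_filter_add_card_filter_not]; simp
    have hO : O.card ≤ k := by simpa using O.card_le_univ
    have h2 : 2 ^ O.card * 2 ^ (k - O.card) = 2 ^ k := by
      rw [← pow_add, Nat.add_sub_cancel' hO]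
    have h3 := Nat.mul_le_mul_right (2 ^ (k - O.card)) hV
    nlinarith
  have hbad' : (2 : ℝ) ^ k ≤ 2 * bad.card := by exact_mod_cast hbad
  calc 1 / 2 * ε ^ J.card ≤ (1 / 2 : ℝ) ^ k * bad.card * ε ^ J.card := by
        gcongr
        rw [one_div_pow, one_div_mul_eq_div, div_le_div_iff₀ (by norm_num) (by positivity)]
        linarith
    _ = ∑ u ∈ bad, ∑ y ∈ Fintype.piFinset t,
          (1 / 2 : ℝ) ^ k * (∏ i, becProb ε (D.encode u i) (y i)) := by
        simp_rw [← Finset.mul_sum, herased]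
        simp
        ring
    _ ≤ ∑ u ∈ bad, ∑ y ∈ Fintype.piFinset t,
          (1 / 2 : ℝ) ^ k * (∏ i, becProb ε (D.encode u i) (y i)) *
            (if D.circuit.compute y = u then 0 else 1) := by
        refine Finset.sum_le_sum fun u hu => Finset.sum_le_sum fun y hy => ?_
        rw [if_neg, mul_one]
        rintro rfl
        refine (Finset.mem_filter.1 hu).2 (hJ y fun j hj => ?_)
        simpa [t, hj] using Fintype.mem_piFinset.1 hy j
    _ ≤ D.blockErrorProb ε := by
        have hterm : ∀ (u : Fin k → Bool) (y : Fin n → Option Bool),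
            0 ≤ (1 / 2 : ℝ) ^ k * (∏ i, becProb ε (D.encode u i) (y i)) *
              (if D.circuit.compute y = u then 0 else 1) := fun u y =>
          mul_nonneg (mul_nonneg (by positivity) (Finset.prod_nonneg fun i _ => hbec _ _))
            (by split_ifs <;> norm_num)
        exact (Finset.sum_le_sum fun u _ => Finset.sum_le_sum_of_subset_of_nonneg
          (Finset.subset_univ _) fun y _ _ => hterm u y).trans
          (Finset.sum_le_sum_of_subset_of_nonneg (Finset.subset_univ _)
            fun u _ _ => Finset.sum_nonneg fun y _ => hterm u y)

open scoped Classical in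
/-- The wire ends through which the nodes in `S` receive bits from other nodes. -/
noncomputable def Layout.inPorts (L : Layout) (S : Set L.Node) : Finset (L.Wire × Bool) :=
  Finset.univ.filter fun p => L.endNode p ∈ S ∧ L.endNode (L.opposite p) ∉ S

namespace Circuit

variable {α : Type} {n k : ℕ} (C : Circuit α n k)

/-- The bits that enter `S` during the computation on the input word `x`. -/
def incoming (S : Set C.Node) (x : Fin n → α) :
    Fin C.cycles × C.toLayout.inPorts S → Bool :=
  fun q => C.send (C.endNode (C.opposite q.2.1)) (C.stateAt x q.1 _) ⟨C.opposite q.2.1, rfl⟩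

/-- By induction on time: a part learns about the outside only through the bits on its incoming wire
ends. -/
theorem stateAt_congr (S : Set C.Node) {x x' : Fin n → α}
    (hx : ∀ j, C.input j ∈ S → x j = x' j) (hin : C.incoming S x = C.incoming S x') :
    ∀ t ≤ C.cycles, ∀ v ∈ S, C.stateAt x t v = C.stateAt x' t v
  | 0, _, v, hv => by
      simp only [stateAt]
      congr 1
      funext ⟨j, hj⟩
      exact hx j (hj ▸ hv)
  | t + 1, ht, v, hv => by
      have ih := stateAt_congr S hx hin t (by omega)
      simp only [stateAt]
      rw [ih v hv]
      congr 1
      funext ⟨p, hp⟩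
      by_cases h : C.endNode (C.opposite p) ∈ S
      · simp only [ih _ h]
      · have hmem : p ∈ C.toLayout.inPorts S := by
          simp only [Layout.inPorts, Finset.mem_filter, Finset.mem_univ, true_and]
          exact ⟨by rw [hp]; exact hv, h⟩
        exact congrFun hin (⟨t, ht⟩, ⟨p, hmem⟩)

end Circuit

open scoped Classical in
/-- A part of the circuit that receives fewer bits than it has outputs guesses wrong with
probability at least `1 / 2` when all its inputs are erased. -/
theorem Decoder.half_mul_pow_le_of_inPorts {n k : ℕ} (D : Decoder n k) {ε : ℝ}
    (hε0 : 0 ≤ ε) (hε1 : ε ≤ 1) (S : Set D.circuit.Node)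
    (hS : D.circuit.cycles * (D.circuit.toLayout.inPorts S).card <
      (Finset.univ.filter fun o => D.circuit.output o ∈ S).card) :
    1 / 2 * ε ^ (Finset.univ.filter fun j => D.circuit.input j ∈ S).card
      ≤ D.blockErrorProb ε := by
  let C := D.circuit
  let J := Finset.univ.filter fun j => C.input j ∈ S
  let O := Finset.univ.filter fun o => C.output o ∈ S
  let Y : Finset (Fin n → Option Bool) := Finset.univ.filter fun y => ∀ j ∈ J, y j = none
  let V : Finset (O → Bool) := Y.image fun y o => C.compute y o
  refine D.half_mul_pow_le_blockErrorProb hε0 hε1 J O V ?_ fun y hy =>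
    Finset.mem_image_of_mem (fun (y : Fin n → Option Bool) (o : O) => C.compute y o)
      (Finset.mem_filter.2 ⟨Finset.mem_univ y, hy⟩)
  have hfac : ∀ y ∈ Y, ∀ y' ∈ Y, C.incoming S y = C.incoming S y' →
      (fun o : O => C.compute y o) = fun o : O => C.compute y' o := by
    intro y hy y' hy' h
    funext ⟨o, ho⟩
    have := C.stateAt_congr S (fun j hj => ?_) h C.cycles le_rfl (C.output o)
      (Finset.mem_filter.1 ho).2
    · simp only [Circuit.compute, this]
    · have hj' : j ∈ J := Finset.mem_filter.2 ⟨Finset.mem_univ _, hj⟩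
      rw [(Finset.mem_filter.1 hy).2 j hj', (Finset.mem_filter.1 hy').2 j hj']
  have hcard : V.card ≤ (Y.image (C.incoming S)).card := by
    refine Finset.card_le_card_of_forall_subsingleton
      (fun v z => ∃ y ∈ Y, v = (fun o : O => C.compute y o) ∧ z = C.incoming S y) ?_ ?_
    · intro v hv
      obtain ⟨y, hy, rfl⟩ := Finset.mem_image.1 hv
      exact ⟨_, Finset.mem_image_of_mem _ hy, y, hy, rfl, rfl⟩
    · rintro z - v ⟨-, y, hy, rfl, rfl⟩ v' ⟨-, y', hy', rfl, h⟩
      exact hfac y hy y' hy' h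
  have huniv := (Y.image (C.incoming S)).card_le_univ
  rw [Fintype.card_fun, Fintype.card_prod, Fintype.card_fin, Fintype.card_coe,
    Fintype.card_bool] at huniv
  -- The strict inequality in `hS` leaves one spare bit, which absorbs the factor 2.
  calc 2 * V.card ≤ 2 * 2 ^ (C.cycles * (C.toLayout.inPorts S).card) := by omega
    _ = 2 ^ (C.cycles * (C.toLayout.inPorts S).card + 1) := by ring
    _ ≤ 2 ^ O.card := Nat.pow_le_pow_right (by norm_num) hS

open scoped Classical in
/-- In a partition of a decoder into parts with at most `a` inputs, the cut wires can carry at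
least `k` bits, unless the error probability is large. -/
theorem Decoder.bits_le_two_mul_cycles_mul_cut {n k : ℕ} (D : Decoder n k) {ε : ℝ}
    (hε0 : 0 ≤ ε) (hε1 : ε ≤ 1) (a : ℕ) (herr : D.blockErrorProb ε < 1 / 2 * ε ^ a)
    (g : D.circuit.Node → ℕ)
    (hg : ∀ c, (Finset.univ.filter fun j => g (D.circuit.input j) = c).card ≤ a) :
    k ≤ 2 * D.circuit.cycles * (Finset.univ.filter fun w =>
      g (D.circuit.src w) ≠ g (D.circuit.tgt w)).card := by
  let C := D.circuit
  have hpart : ∀ c, (Finset.univ.filter fun o => g (C.output o) = c).card ≤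
      C.cycles * (C.toLayout.inPorts (g ⁻¹' {c})).card := by
    intro c
    by_contra! h
    refine absurd (D.half_mul_pow_le_of_inPorts hε0 hε1 (g ⁻¹' {c}) ?_) (not_le.2 ?_)
    · simpa using h
    · refine herr.trans_le ?_
      gcongr 1 / 2 * ?_
      exact pow_le_pow_of_le_one hε0 hε1 (by simpa using hg c)
  let R : Finset ℕ := Finset.univ.image g
  let P : Finset (C.Wire × Bool) :=
    Finset.univ.filter fun p => g (C.endNode p) ≠ g (C.endNode (C.opposite p))
  have hP : P.card = 2 * (Finset.univ.filter fun w => g (C.src w) ≠ g (C.tgt w)).card := by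
    have : P = (Finset.univ.filter fun w => g (C.src w) ≠ g (C.tgt w)) ×ˢ Finset.univ := by
      ext ⟨w, b⟩
      cases b <;> simp [P, C, Layout.endNode, Layout.opposite, ne_comm]
    rw [this, Finset.card_product]
    simp [mul_comm]
  -- Each end of a cut wire is an incoming port of exactly one part, the one containing its node.
  have hsum : ∑ c ∈ R, (C.toLayout.inPorts (g ⁻¹' {c})).card = P.card := by
    rw [Finset.card_eq_sum_card_fiberwise (f := fun p => g (C.endNode p)) (t := R)
      (fun p _ => Finset.mem_coe.2 (Finset.mem_image_of_mem g (Finset.mem_univ _)))]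
    refine Finset.sum_congr rfl fun c _ => congrArg _ ?_
    ext p
    simp only [Layout.inPorts, P, Finset.mem_filter, Finset.mem_univ, true_and,
      Set.mem_preimage, Set.mem_singleton_iff]
    constructor
    · rintro ⟨rfl, h⟩; exact ⟨Ne.symm h, rfl⟩
    · rintro ⟨h, rfl⟩; exact ⟨rfl, Ne.symm h⟩
  calc k = (Finset.univ : Finset (Fin k)).card := by simp
    _ = ∑ c ∈ R, (Finset.univ.filter fun o => g (C.output o) = c).card :=
        Finset.card_eq_sum_card_fiberwise
          (fun o _ => Finset.mem_coe.2 (Finset.mem_image_of_mem g (Finset.mem_univ _)))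
    _ ≤ ∑ c ∈ R, C.cycles * (C.toLayout.inPorts (g ⁻¹' {c})).card :=
        Finset.sum_le_sum fun c _ => hpart c
    _ = _ := by rw [← Finset.mul_sum, hsum, hP]; ring

end VLSI

/-! ### Partitions of a planar layout with a small cut -/

namespace VLSI

/-- The squares are ordered by the strip `σ x` that contains them, then by rows. -/
def StripLT (σ : ℤ → ℤ) (p q : ℤ × ℤ) : Prop :=
  σ p.1 < σ q.1 ∨ σ p.1 = σ q.1 ∧ (p.2 < q.2 ∨ p.2 = q.2 ∧ p.1 < q.1)

namespace StripLT

variable {σ : ℤ → ℤ} {p q r : ℤ × ℤ}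

theorem irrefl : ¬ StripLT σ p p := by
  unfold StripLT; omega

theorem trans (h : StripLT σ p q) (h' : StripLT σ q r) : StripLT σ p r := by
  unfold StripLT at *; omega

theorem trichotomy (h : p ≠ q) : StripLT σ p q ∨ StripLT σ q p := by
  obtain ⟨x, y⟩ := p
  obtain ⟨x', y'⟩ := q
  unfold StripLT
  rcases lt_trichotomy x x' with hx | hx | hx
  · dsimp only; omega
  · have hy : y ≠ y' := fun hy => h (by rw [hx, hy])
    subst hx
    dsimp only; omega
  · dsimp only; omega

end StripLT

open scoped Classical in
/-- The number of marked squares that precede a square. -/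
noncomputable def rank {n : ℕ} (m : Fin n → ℤ × ℤ) (σ : ℤ → ℤ) (p : ℤ × ℤ) : ℕ :=
  (Finset.univ.filter fun j => StripLT σ (m j) p).card

section rank

variable {n : ℕ} (m : Fin n → ℤ × ℤ) (σ : ℤ → ℤ)

theorem rank_le (p : ℤ × ℤ) : rank m σ p ≤ n := by
  classical
  simpa [rank] using (Finset.univ.filter fun j => StripLT σ (m j) p).card_le_univ

theorem rank_mono {p q : ℤ × ℤ} (h : StripLT σ p q ∨ p = q) : rank m σ p ≤ rank m σ q := by
  classical
  rcases h with h | rfl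
  · exact Finset.card_le_card fun j hj => by
      simp only [Finset.mem_filter, Finset.mem_univ, true_and] at hj ⊢
      exact hj.trans h
  · exact le_rfl

theorem rank_lt {i : Fin n} {q : ℤ × ℤ} (h : StripLT σ (m i) q) :
    rank m σ (m i) < rank m σ q := by
  classical
  refine Finset.card_lt_card ⟨fun j hj => ?_, fun hsub => ?_⟩
  · simp only [Finset.mem_filter, Finset.mem_univ, true_and] at hj ⊢
    exact hj.trans h
  · have := @hsub i (by simpa using h)
    simp [StripLT.irrefl] at this

/-- Distinct marked squares have distinct ranks, and a group is a block of `a` consecutive ranks. -/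
theorem card_rank_div_eq_le (hm : Function.Injective m) {a : ℕ} (ha : 0 < a) (c : ℕ) :
    (Finset.univ.filter fun j => rank m σ (m j) / a = c).card ≤ a := by
  have h := Finset.card_le_card_of_injOn
    (s := Finset.univ.filter fun j => rank m σ (m j) / a = c)
    (t := Finset.Ico (c * a) (c * a + a)) (fun j => rank m σ (m j)) (fun j hj => ?_)
    (fun i _ j _ hij => ?_)
  · simpa using h
  · have hj : rank m σ (m j) / a = c := by simpa using hj
    have := (Nat.div_eq_iff ha).1 hj
    simp only [Finset.coe_Ico, Set.mem_Ico]
    omega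
  · by_contra hne
    rcases StripLT.trichotomy (σ := σ) (hm.ne hne) with h | h
    · exact (rank_lt m σ h).ne hij
    · exact (rank_lt m σ h).ne' hij

end rank

/-- The right neighbour or the upper neighbour of a square. -/
def neighbour (p : ℤ × ℤ) (b : Bool) : ℤ × ℤ := if b then (p.1 + 1, p.2) else (p.1, p.2 + 1)

theorem exists_neighbour_of_adj {p q : ℤ × ℤ} (h : gridGraph.Adj p q) :
    ∃ b, q = neighbour p b ∨ p = neighbour q b := by
  obtain ⟨x, y⟩ := p
  obtain ⟨x', y'⟩ := q
  have h : |x - x'| + |y - y'| = 1 := h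
  have : (x' = x + 1 ∧ y' = y ∨ x = x' + 1 ∧ y = y') ∨
      (x' = x ∧ y' = y + 1 ∨ x = x' ∧ y = y' + 1) := by
    rcases abs_cases (x - x') with h1 | h1 <;> rcases abs_cases (y - y') with h2 | h2 <;> omega
  rcases this with h | h
  · exact ⟨true, by simpa [neighbour] using h⟩
  · exact ⟨false, by simpa [neighbour] using h⟩

theorem neighbour_pair_injective :
    Function.Injective fun z : (ℤ × ℤ) × Bool => s(z.1, neighbour z.1 z.2) := by
  rintro ⟨⟨x, y⟩, b⟩ ⟨⟨x', y'⟩, b'⟩ h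
  cases b <;> cases b' <;> simp [neighbour] at h ⊢ <;> omega

open scoped Classical in
/-- Wires whose ends have different colours are at most as many as the sides of occupied squares
at which the colour changes. -/
theorem Layout.card_cut_le (L : Layout) (h : ℤ × ℤ → ℕ) :
    (Finset.univ.filter fun w => h (L.pos (L.src w)) ≠ h (L.pos (L.tgt w))).card ≤
      ((L.occupied ×ˢ (Finset.univ : Finset Bool)).filter
        fun z => h z.1 ≠ h (neighbour z.1 z.2)).card := by
  have key : ∀ w, h (L.pos (L.src w)) ≠ h (L.pos (L.tgt w)) → ∃ z : (ℤ × ℤ) × Bool,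
      z.1 ∈ L.occupied ∧ h z.1 ≠ h (neighbour z.1 z.2) ∧
        s(z.1, neighbour z.1 z.2) ∈ (L.route w).edges := by
    intro w hw
    -- Somewhere along its route the wire leaves the colour of its source. Different wires share no
    -- side, so the choice of such a side is injective.
    obtain ⟨d, hd, h1, h2⟩ := (L.route w).exists_boundary_dart
      {p | h p = h (L.pos (L.src w))} rfl (fun h' => hw h'.symm)
    have hne : h d.fst ≠ h d.snd := fun h' => h2 (h'.symm.trans h1)
    have hocc : ∀ p ∈ (L.route w).support, p ∈ L.occupied := fun p hp =>
      Finset.mem_union_right _ (Finset.mem_biUnion.2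
        ⟨w, Finset.mem_univ _, List.mem_toFinset.2 hp⟩)
    have hedge : s(d.fst, d.snd) ∈ (L.route w).edges := List.mem_map_of_mem hd
    obtain ⟨b, hb | hb⟩ := exists_neighbour_of_adj d.adj
    · exact ⟨(d.fst, b), hocc _ ((L.route w).fst_mem_support_of_mem_edges hedge),
        by rwa [← hb], by rwa [← hb]⟩
    · exact ⟨(d.snd, b), hocc _ ((L.route w).snd_mem_support_of_mem_edges hedge),
        by rw [← hb]; exact hne.symm, by rw [← hb, Sym2.eq_swap]; exact hedge⟩
  choose! z hz using key
  refine Finset.card_le_card_of_injOn z (fun w hw => ?_) (fun w hw w' hw' hww => ?_)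
  · have hw := hz w (by simpa using hw)
    exact Finset.mem_coe.2 (Finset.mem_filter.2
      ⟨Finset.mem_product.2 ⟨hw.1, Finset.mem_univ _⟩, hw.2.1⟩)
  · have hw := hz w (by simpa using hw)
    have hw' := hz w' (by simpa using hw')
    by_contra hne
    exact L.route_disjoint w w' hne hw.2.2 (by rw [hww]; exact hw'.2.2)

open scoped Classical in
/-- The sides inside a strip at which the group of a square changes: at most `s + 1` for each
boundary between consecutive groups. -/
theorem card_inner_cut_le {n : ℕ} (m : Fin n → ℤ × ℤ) {s : ℕ} (hs : 0 < s) (r : ℤ) {a : ℕ}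
    (B : Finset ((ℤ × ℤ) × Bool)) (σ : ℤ → ℤ) (hσ : ∀ x, σ x = (x - r) / s)
    (hB : ∀ z ∈ B, rank m σ z.1 / a ≠ rank m σ (neighbour z.1 z.2) / a ∧
      σ (neighbour z.1 z.2).1 = σ z.1.1) :
    B.card ≤ n / a * (s + 1) := by
  have hstep : ∀ z ∈ B, StripLT σ z.1 (neighbour z.1 z.2) := by
    rintro ⟨p, b⟩ hz
    have := (hB _ hz).2
    unfold StripLT
    cases b
    · simp [neighbour]
    · simp [neighbour] at this ⊢
      omega
  have hlt : ∀ z ∈ B, rank m σ z.1 / a < rank m σ (neighbour z.1 z.2) / a := fun z hz =>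
    lt_of_le_of_ne (Nat.div_le_div_right (rank_mono m σ (Or.inl (hstep z hz)))) (hB z hz).1
  -- Sides between vertical neighbours are tagged by the column within the strip, those between
  -- horizontal neighbours by `s`: `s + 1` tags in all.
  let tag : (ℤ × ℤ) × Bool → ℤ := fun z => if z.2 then s else (z.1.1 - r) % s
  have hs' : (0 : ℤ) < s := by exact_mod_cast hs
  have hmod : ∀ x : ℤ, 0 ≤ x % (s : ℤ) ∧ x % (s : ℤ) < s := fun x =>
    ⟨Int.emod_nonneg _ hs'.ne', Int.emod_lt_of_pos _ hs'⟩
  have htag : ∀ z z', tag z = tag z' → z.2 = z'.2 := by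
    rintro ⟨p, b⟩ ⟨p', b'⟩ h
    have h1 := hmod (p.1 - r)
    have h2 := hmod (p'.1 - r)
    cases b <;> cases b' <;> simp [tag] at h ⊢ <;> omega
  -- Sides with the same tag span non-overlapping intervals of the order, so at most one of them
  -- leads into any given group.
  have hnext : ∀ z ∈ B, ∀ z' ∈ B, tag z = tag z' → StripLT σ z.1 z'.1 →
      StripLT σ (neighbour z.1 z.2) z'.1 ∨ neighbour z.1 z.2 = z'.1 := by
    rintro ⟨⟨x, y⟩, b⟩ hz ⟨⟨x', y'⟩, b'⟩ hz' ht hlt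
    obtain rfl : b = b' := htag _ _ ht
    have hst := (hB _ hz).2
    unfold StripLT at hlt ⊢
    cases b
    · simp only [neighbour, Bool.false_eq_true, if_false, tag, Prod.mk.injEq] at *
      by_cases hxx : σ x = σ x'
      · have : x = x' := by
          rw [hσ, hσ] at hxx
          have h1 := Int.emod_add_mul_ediv (x - r) s
          have h2 := Int.emod_add_mul_ediv (x' - r) s
          rw [ht, hxx] at h1
          omega
        subst this
        omega
      · omega
    · simp only [neighbour, if_true, Prod.mk.injEq] at *
      by_cases hxx : x + 1 = x'
      · subst hxx
        omega
      · omega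
  have h := Finset.card_le_card_of_injOn (s := B)
    (t := Finset.Icc 1 (n / a) ×ˢ Finset.Icc (0 : ℤ) s)
    (fun z => (rank m σ (neighbour z.1 z.2) / a, tag z)) (fun z hz => ?_)
    (fun z hz z' hz' h => ?_)
  · simpa using h
  · have h1 := hlt z hz
    have h2 : rank m σ (neighbour z.1 z.2) / a ≤ n / a := Nat.div_le_div_right (rank_le m σ _)
    have h3 : 0 ≤ tag z ∧ tag z ≤ s := by
      have := hmod (z.1.1 - r)
      simp only [tag]
      split_ifs <;> omega
    simp only [Finset.coe_product, Finset.coe_Icc, Set.mem_prod, Set.mem_Icc]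
    exact ⟨⟨Nat.one_le_iff_ne_zero.2 (Nat.ne_zero_of_lt h1), h2⟩, h3⟩
  · simp only [Prod.mk.injEq] at h
    have hle : ∀ z ∈ B, ∀ z' ∈ B, tag z = tag z' →
        rank m σ (neighbour z.1 z.2) / a = rank m σ (neighbour z'.1 z'.2) / a →
        ¬ StripLT σ z.1 z'.1 := fun z hz z' hz' ht hr hl =>
      absurd (Nat.div_le_div_right (c := a) (rank_mono m σ (hnext z hz z' hz' ht hl)))
        (not_le.2 (hr ▸ hlt z' hz'))
    by_contra hne
    rcases StripLT.trichotomy (σ := σ) (p := z.1) (q := z'.1)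
      (fun h' => hne (Prod.ext h' (htag z z' h.2))) with hl | hl
    · exact hle z hz z' hz' h.2 h.1 hl
    · exact hle z' hz' z hz h.2.symm h.1.symm hl

open scoped Classical in
/-- The nodes of a layout can be partitioned so that every part has at most `a` of the `n` marked
nodes, and few wires run between different parts. -/
theorem Layout.exists_partition (L : Layout) {n : ℕ} (input : Fin n → L.Node)
    (hinput : Function.Injective input) {s a : ℕ} (hs : 0 < s) (ha : 0 < a) :
    ∃ g : L.Node → ℕ, (∀ c, (Finset.univ.filter fun j => g (input j) = c).card ≤ a) ∧
      ((Finset.univ.filter fun w => g (L.src w) ≠ g (L.tgt w)).card : ℝ) ≤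
        (L.area : ℝ) / s + (n : ℝ) / a * (s + 1) := by
  have hs' : (0 : ℤ) < s := by exact_mod_cast hs
  -- By pigeonhole over the `s` offsets, some placement of the strip walls has at most `A / s`
  -- occupied squares with a wall on their right.
  obtain ⟨r, hr, hcard⟩ := Finset.exists_card_fiber_le_of_card_le_nsmul
    (s := L.occupied) (t := Finset.Ico (0 : ℤ) s) (f := fun p => (p.1 + 1) % (s : ℤ))
    (b := (L.area : ℝ) / s) ⟨0, by simpa using hs⟩
    (by simp [Layout.area, mul_div_cancel₀, hs.ne'])
  let m : Fin n → ℤ × ℤ := fun j => L.pos (input j)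
  let σ : ℤ → ℤ := fun x => (x - r) / s
  refine ⟨fun v => rank m σ (L.pos v) / a,
    card_rank_div_eq_le m σ (L.pos_injective.comp hinput) ha, ?_⟩
  have hcut := L.card_cut_le fun p => rank m σ p / a
  set X := (L.occupied ×ˢ (Finset.univ : Finset Bool)).filter
    fun z => rank m σ z.1 / a ≠ rank m σ (neighbour z.1 z.2) / a
  let B := X.filter fun z => σ (neighbour z.1 z.2).1 = σ z.1.1
  have hB : B.card ≤ n / a * (s + 1) := card_inner_cut_le m hs r B σ (fun _ => rfl)
    fun z hz => ⟨(Finset.mem_filter.1 (Finset.mem_filter.1 hz).1).2, (Finset.mem_filter.1 hz).2⟩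
  have hstrip : ∀ x, σ (x + 1) ≠ σ x → (x + 1) % (s : ℤ) = r := by
    intro x hx
    have h1 := Int.emod_nonneg (x - r) hs'.ne'
    have h2 := Int.emod_lt_of_pos (x - r) hs'
    have h3 := Int.emod_add_mul_ediv (x - r) s
    have h4 : (x - r) % (s : ℤ) + 1 = s := by
      by_contra hne
      refine hx ((Int.ediv_emod_unique hs' (r := (x - r) % s + 1)).2 ⟨?_, by omega, by omega⟩).1
      simp only [σ]
      linarith
    have h5 : x + 1 = r + s * ((x - r) / s + 1) := by linarith
    rw [h5, Int.add_mul_emod_self_left]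
    exact Int.emod_eq_of_lt (Finset.mem_Ico.1 hr).1 (Finset.mem_Ico.1 hr).2
  -- Only a step to the right can leave a strip, so each square accounts for at most one such side.
  have hout : (X.filter fun z => ¬ σ (neighbour z.1 z.2).1 = σ z.1.1).card ≤
      (L.occupied.filter fun p => (p.1 + 1) % (s : ℤ) = r).card := by
    have hb : ∀ z : (ℤ × ℤ) × Bool, ¬ σ (neighbour z.1 z.2).1 = σ z.1.1 → z.2 = true := by
      rintro ⟨p, b⟩ h
      cases b
      · exact absurd rfl h
      · rfl
    refine Finset.card_le_card_of_injOn (fun z => z.1) (fun z hz => ?_) (fun z hz z' hz' h => ?_)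
    · have hz := Finset.mem_filter.1 (Finset.mem_coe.1 hz)
      have hocc := (Finset.mem_product.1 (Finset.mem_filter.1 hz.1).1).1
      refine Finset.mem_coe.2 (Finset.mem_filter.2 ⟨hocc, hstrip _ ?_⟩)
      simpa [neighbour, hb z hz.2] using hz.2
    · have hz := Finset.mem_filter.1 (Finset.mem_coe.1 hz)
      have hz' := Finset.mem_filter.1 (Finset.mem_coe.1 hz')
      exact Prod.ext h ((hb z hz.2).trans (hb z' hz'.2).symm)
  have hX : X.card = B.card + (X.filter fun z => ¬ σ (neighbour z.1 z.2).1 = σ z.1.1).card :=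
    (Finset.card_filter_add_card_filter_not _).symm
  have hB' : (B.card : ℝ) ≤ (n : ℝ) / a * (s + 1) :=
    calc (B.card : ℝ) ≤ ((n / a * (s + 1) : ℕ) : ℝ) := by exact_mod_cast hB
      _ ≤ (n : ℝ) / a * (s + 1) := by
        push_cast
        gcongr
        exact Nat.cast_div_le
  have hout' := (Nat.cast_le (α := ℝ)).2 hout
  have hcut' := (Nat.cast_le (α := ℝ)).2 hcut
  rw [hX] at hcut'
  push_cast at hcut'
  linarith

end VLSI

/-! ### The bound on area times squared time -/

namespace VLSI

theorem Layout.card_le_area (L : Layout) {n : ℕ} (input : Fin n → L.Node)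
    (hinput : Function.Injective input) : n ≤ L.area := by
  classical
  have h := Finset.card_le_card (s := Finset.univ.image (L.pos ∘ input))
    (t := L.occupied) fun p hp => by
      obtain ⟨j, -, rfl⟩ := Finset.mem_image.1 hp
      exact Finset.mem_union_left _ (Finset.mem_image_of_mem _ (Finset.mem_univ _))
  rwa [Finset.card_image_of_injective _ (L.pos_injective.comp hinput), Finset.card_univ,
    Fintype.card_fin] at h

/-- A decoder with small error probability satisfies `k² a ≤ 64 T² A n`. -/
theorem Decoder.sq_mul_le {n k : ℕ} (D : Decoder n k) {ε : ℝ} (hε0 : 0 ≤ ε) (hε1 : ε ≤ 1)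
    (hn : 0 < n) {a : ℕ} (ha : 0 < a) (herr : D.blockErrorProb ε < 1 / 2 * ε ^ a) :
    (k : ℝ) ^ 2 * a ≤ 64 * (D.circuit.cycles : ℝ) ^ 2 * D.circuit.area * n := by
  set A : ℝ := (D.circuit.area : ℝ)
  set T : ℝ := (D.circuit.cycles : ℝ) with hT
  have hn' : (0 : ℝ) < n := by exact_mod_cast hn
  have ha' : (1 : ℝ) ≤ a := by exact_mod_cast ha
  have hnA : (n : ℝ) ≤ A :=
    Nat.cast_le.2 (D.circuit.toLayout.card_le_area _ D.circuit.input_injective)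
  have hA : 0 < A := hn'.trans_le hnA
  have hT0 : 0 ≤ T := Nat.cast_nonneg _
  -- This strip width balances `A / s` against `n s / a`; it is at least 1 because `A ≥ n`, and
  -- rounding it down loses at most a factor 2.
  set r : ℝ := √(A * a / n)
  have hr2 : r ^ 2 = A * a / n := Real.sq_sqrt (by positivity)
  have hr1 : 1 ≤ r := by
    rw [Real.one_le_sqrt, one_le_div hn']
    nlinarith
  have hr0 : 0 < r := by linarith
  have hs : 0 < ⌊r⌋₊ := Nat.floor_pos.2 hr1
  have hs1 : (1 : ℝ) ≤ ⌊r⌋₊ := by exact_mod_cast hs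
  have hsr : (⌊r⌋₊ : ℝ) ≤ r := Nat.floor_le hr0.le
  have hrs : r < ⌊r⌋₊ + 1 := Nat.lt_floor_add_one r
  obtain ⟨g, hg, hcut⟩ :=
    D.circuit.toLayout.exists_partition _ D.circuit.input_injective hs ha
  have hk := (Nat.cast_le (α := ℝ)).2 (D.bits_le_two_mul_cycles_mul_cut hε0 hε1 a herr g hg)
  push_cast at hk
  rw [← hT] at hk
  have h1 : A / ⌊r⌋₊ ≤ 2 * (A / r) := by
    rw [← mul_div_assoc, div_le_div_iff₀ (by linarith) hr0]
    nlinarith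
  have h2 : (n : ℝ) / a * (⌊r⌋₊ + 1) ≤ 2 * (A / r) :=
    calc (n : ℝ) / a * (⌊r⌋₊ + 1) ≤ n / a * (2 * r) := by gcongr; linarith
      _ = 2 * (A / r) := by
        have : A = r ^ 2 * n / a := by rw [hr2]; field_simp
        rw [this]
        field_simp
  have h3 : (k : ℝ) ≤ 8 * T * (A / r) := by
    refine hk.trans ((mul_le_mul_of_nonneg_left (hcut.trans (add_le_add h1 h2))
      (by positivity)).trans_eq (by ring))
  calc (k : ℝ) ^ 2 * a ≤ (8 * T * (A / r)) ^ 2 * a := by gcongr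
    _ = 64 * T ^ 2 * A ^ 2 * a / r ^ 2 := by ring
    _ = 64 * T ^ 2 * A * n := by rw [hr2]; field_simp

/-- A decoder of rate at least `ρ` with block error probability below `exp (-l)` satisfies
`A T² ≥ c n l`, with a constant that depends only on `ε` and `ρ`. -/
theorem exists_area_mul_cycles_sq_ge {ε ρ : ℝ} (hε0 : 0 < ε) (hε1 : ε < 1) (hρ : 0 < ρ) :
    ∃ c : ℝ, 0 < c ∧ ∀ (n k : ℕ) (D : Decoder n k) (l : ℝ), 0 < n → ρ * n ≤ k →
      D.blockErrorProb ε < Real.exp (-l) →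
      c * (n * l) ≤ D.circuit.area * (D.circuit.cycles : ℝ) ^ 2 := by
  set lam : ℝ := -Real.log ε with hlam
  have hlam0 : 0 < lam := neg_pos.2 (Real.log_neg hε0 hε1)
  have hlog2 : 0 < Real.log 2 := Real.log_pos (by norm_num)
  set l₀ : ℝ := 2 * (Real.log 2 + lam) with hl₀
  have hl₀0 : 0 < l₀ := by positivity
  -- The first constant serves `l ≤ l₀`, where `A ≥ n` and `T ≥ 1` suffice; the second serves larger
  -- `l`.
  refine ⟨min (1 / l₀) (ρ ^ 2 / (128 * lam)), by positivity, fun n k D l hn hk herr => ?_⟩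
  have hn' : (0 : ℝ) < n := by exact_mod_cast hn
  have hnA : (n : ℝ) ≤ D.circuit.area := by
    exact_mod_cast D.circuit.toLayout.card_le_area _ D.circuit.input_injective
  have hT : (1 : ℝ) ≤ D.circuit.cycles := by exact_mod_cast D.circuit.cycles_pos
  rcases le_or_gt l 0 with hl | hl
  · exact (mul_nonpos_of_nonneg_of_nonpos (by positivity)
      (mul_nonpos_of_nonneg_of_nonpos hn'.le hl)).trans (by positivity)
  rcases le_or_gt l l₀ with hll | hll
  · calc _ ≤ 1 / l₀ * (n * l) := by gcongr; exact min_le_left _ _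
      _ ≤ 1 / l₀ * (n * l₀) := by gcongr
      _ = n * 1 := by field_simp
      _ ≤ _ := by gcongr; exact one_le_pow₀ hT
  -- The largest `a` with `exp (-l) ≤ ε ^ a / 2`. Since `l > l₀`, the loss from `log 2` and from
  -- rounding is below `l / 2`, whence `l ≤ 2 * lam * a`.
  · set a := ⌊(l - Real.log 2) / lam⌋₊
    have ha1 : (a : ℝ) ≤ (l - Real.log 2) / lam :=
      Nat.floor_le (div_nonneg (by linarith) hlam0.le)
    have ha2 : (l - Real.log 2) / lam < a + 1 := Nat.lt_floor_add_one _
    rw [le_div_iff₀ hlam0] at ha1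
    rw [div_lt_iff₀ hlam0] at ha2
    have ha3 : l ≤ 2 * lam * a := by linarith
    have ha0 : 0 < a := by
      rw [Nat.pos_iff_ne_zero]
      intro h
      rw [h] at ha3
      simp at ha3
      linarith
    have herr' : D.blockErrorProb ε < 1 / 2 * ε ^ a := by
      refine herr.trans_le ?_
      rw [← Real.log_le_log_iff (Real.exp_pos _) (by positivity), Real.log_exp,
        Real.log_mul (by norm_num) (by positivity), Real.log_pow, one_div, Real.log_inv]
      linarith
    have hmain := D.sq_mul_le hε0.le hε1.le hn ha0 herr'
    have h1 : (ρ * n) ^ 2 * (l / (2 * lam)) ≤ (k : ℝ) ^ 2 * a := by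
      gcongr
      rw [div_le_iff₀ (by positivity)]
      linarith
    have h2 : ρ ^ 2 / (128 * lam) * (n * l) * (64 * n) ≤
        D.circuit.area * (D.circuit.cycles : ℝ) ^ 2 * (64 * n) :=
      calc _ = (ρ * n) ^ 2 * (l / (2 * lam)) := by field_simp; ring
        _ ≤ _ := h1.trans hmain
        _ = _ := by ring
    calc _ ≤ ρ ^ 2 / (128 * lam) * (n * l) := by gcongr; exact min_le_right _ _
      _ ≤ _ := le_of_mul_le_mul_right h2 (by positivity)

end VLSI

/-! ### Asymptotic form -/

theorem mainTheorem3 (ε : ℝ) (hε0 : 0 < ε) (hε1 : ε < 1)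
    (f : ℕ → ℝ) (hf : VLSI.IsSubexponential f)
    (D : VLSI.DecodingScheme) (hD : D.IsFDecoding ε f)
    (R : ℝ) (hR : 0 < R) (hrate : D.HasRate R) :
    (VLSI.IsTheta D.energy
        (fun i => √(-Real.log (f (D.blockLength i))) * (D.blockLength i : ℝ)) →
      VLSI.IsOmega D.cycles (fun i => √(-Real.log (f (D.blockLength i))))) ∧
    VLSI.IsOmega D.energy
      (fun i => (D.blockLength i : ℝ) * (-Real.log (f (D.blockLength i))) / D.cycles i) := by
  obtain ⟨c, hc, hbound⟩ := VLSI.exists_area_mul_cycles_sq_ge hε0 hε1 (half_pos hR)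
  have hpos : ∀ᶠ i in atTop, 0 < D.blockLength i :=
    D.blockLength_strictMono.tendsto_atTop.eventually_gt_atTop 0
  have hk : ∀ᶠ i in atTop, R / 2 < (D.bits i : ℝ) / D.blockLength i :=
    hrate.eventually_const_lt (half_lt_self hR)
  have hf' := D.blockLength_strictMono.tendsto_atTop.eventually hf.1
  have hT : ∀ i, 0 < D.cycles i := fun i =>
    Nat.cast_pos.2 (D.decoder i).circuit.cycles_pos
  have hmain : ∀ᶠ i in atTop,
      c * ((D.blockLength i : ℝ) * (-Real.log (f (D.blockLength i))) / D.cycles i) ≤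
        D.energy i := by
    filter_upwards [hpos, hk, hf', hD] with i hn hk hfi herr
    have hn' : (0 : ℝ) < D.blockLength i := by exact_mod_cast hn
    have h := hbound _ _ (D.decoder i) (-Real.log (f (D.blockLength i))) hn
      ((lt_div_iff₀ hn').1 hk).le (by rwa [neg_neg, Real.exp_log hfi])
    rw [← mul_div_assoc, div_le_iff₀ (hT i)]
    refine h.trans_eq ?_
    simp only [VLSI.DecodingScheme.energy, VLSI.DecodingScheme.cycles, VLSI.Circuit.energy]
    ring
  refine ⟨fun ⟨_, b, _, hb, hE⟩ => ⟨c / b, by positivity, ?_⟩, c, hc, hmain⟩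
  filter_upwards [hmain, hE, hpos] with i h1 h2 hn
  have hn' : (0 : ℝ) < D.blockLength i := by exact_mod_cast hn
  rcases le_or_gt (-Real.log (f (D.blockLength i))) 0 with hl | hl
  · rw [Real.sqrt_eq_zero'.2 hl, mul_zero]
    exact (hT i).le
  · have hsq := Real.mul_self_sqrt hl.le
    have hs := Real.sqrt_pos.2 hl
    set q := √(-Real.log (f (D.blockLength i)))
    rw [← hsq] at h1
    have h3 := h1.trans h2.2
    rw [← mul_div_assoc, div_le_iff₀ (hT i)] at h3
    rw [div_mul_eq_mul_div, div_le_iff₀ hb]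
    -- With `N` the block length, `c N q² ≤ E T` and `E ≤ b q N`; the common factor `q N` cancels to
    -- leave `c q ≤ b T`.
    refine le_of_mul_le_mul_right (a := q * D.blockLength i) ?_ (by positivity)
    linarith
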